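/- Let $H$ be a complex Hilbert space and let $A,B$ be positive invertible bounded linear operators on $H$; inequalities between operators are in the Löwner order and $I$ is the identity. For positive invertible $X$, positive $Y$ and $t\in[0,1]$ let $$X\#_tY=X^{1/2}\bigl(X^{-1/2}YX^{-1/2}\bigr)^tX^{1/2},\qquad X\natural_tY=(X^{-1}\#Y)^t\,X\,(X^{-1}\#Y)^t,$$ where $\#=\#_{1/2}$, and write $\natural=\natural_{1/2}$ (the spectral geometric mean). (1) If $0<t\le\tfrac12$, then $$A\natural_tB\le I\ \Longrightarrow\ A^r\,\natural_{\frac{rt}{s(1-t)+rt}}\,B^s\le I$$ for all real $r,s$ with $0<s\le\frac{t}{1-t}$ and $0<r\le\frac{s(1-t)}{t}$. (2) If $\tfrac12\le t<1$, then $$A\natural_tB\le I\ \Longrightarrow\ A^r\,\natural_{\frac{rt}{s(1-t)+rt}}\,B^s\le I$$ for all real $r,s$ with $0<r\le\frac{1-t}{t}$ and $0<s\le\frac{rt}{1-t}$. In particular, $A\natural B\le I$ implies $A^r\,\natural_{\frac{r}{r+s}}\,B^s\le I$ for all $r,s\in(0,1]$. -/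

import Mathlib

/-- The weighted geometric mean `A #ₜ B = A^{1/2} (A^{-1/2} B A^{-1/2})^t A^{1/2}` of bounded
operators on a complex Hilbert space, for `A` positive invertible and `B` positive. Real powers of
positive operators are those of the continuous functional calculus. -/
noncomputable def geomMean {H : Type*} [NormedAddCommGroup H] [InnerProductSpace ℂ H]
    [CompleteSpace H] (t : ℝ) (A B : H →L[ℂ] H) : H →L[ℂ] H :=
  A ^ (1 / 2 : ℝ) * (A ^ (-(1 / 2) : ℝ) * B * A ^ (-(1 / 2) : ℝ)) ^ t * A ^ (1 / 2 : ℝ)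

/-- The weighted spectral geometric mean `A ♮ₜ B = (A⁻¹ # B)^t A (A⁻¹ # B)^t`, where `#` is the
geometric mean with weight `1/2`. -/
noncomputable def spectralGeomMean {H : Type*} [NormedAddCommGroup H] [InnerProductSpace ℂ H]
    [CompleteSpace H] (t : ℝ) (A B : H →L[ℂ] H) : H →L[ℂ] H :=
  geomMean (1 / 2) (Ring.inverse A) B ^ t * A * geomMean (1 / 2) (Ring.inverse A) B ^ t

section OperatorInequalities

variable {H : Type*} [NormedAddCommGroup H] [InnerProductSpace ℂ H] [CompleteSpace H]

/-! Put `C = A⁻¹ # B`, so `C A C = B`. Then `A ♮ₜ B ≤ 1` says both `A ≤ C ^ (-2t)` and `B ≤ C ^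
(2(1-t))`. Löwner–Heinz powers of these bounds, with exponents matched to eliminate `C`, compare `A
^ r` and `B ^ s` directly. With `D = A ^ (-r) # B ^ s`, the identity `D A ^ r D = B ^ s` and
`le_of_mul_mul_le_mul_mul` then compare `D` with a power of `A` (if `t ≤ 1/2`) or of `B` (if `t ≥
1/2`). One more Löwner–Heinz step gives the conclusion. -/

lemma rpow_mul_rpow_neg_mul_mul {D : H →L[ℂ] H} (hD : IsStrictlyPositive D) (x : ℝ)
    (Z : H →L[ℂ] H) : D ^ x * (D ^ (-x) * Z * D ^ (-x)) * D ^ x = Z := by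
  calc D ^ x * (D ^ (-x) * Z * D ^ (-x)) * D ^ x
      = (D ^ x * D ^ (-x)) * Z * (D ^ (-x) * D ^ x) := by simp only [mul_assoc]
    _ = Z := by rw [CFC.rpow_mul_rpow_neg x hD, CFC.rpow_neg_mul_rpow x hD, one_mul, mul_one]

lemma rpow_neg_mul_rpow_mul_mul {D : H →L[ℂ] H} (hD : IsStrictlyPositive D) (x : ℝ)
    (Z : H →L[ℂ] H) : D ^ (-x) * (D ^ x * Z * D ^ x) * D ^ (-x) = Z := by
  simpa only [neg_neg] using rpow_mul_rpow_neg_mul_mul hD (-x) Z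

/-- Conjugation by a real power of a strictly positive operator can be moved across `≤`. -/
lemma rpow_mul_mul_rpow_le_iff {D X Y : H →L[ℂ] H} (hD : IsStrictlyPositive D) (x : ℝ) :
    D ^ x * X * D ^ x ≤ Y ↔ X ≤ D ^ (-x) * Y * D ^ (-x) := by
  constructor
  · intro h
    simpa only [rpow_neg_mul_rpow_mul_mul hD] using
      conjugate_le_conjugate_of_nonneg h (CFC.rpow_nonneg (a := D) (y := -x))
  · intro h
    simpa only [rpow_mul_rpow_neg_mul_mul hD] using
      conjugate_le_conjugate_of_nonneg h (CFC.rpow_nonneg (a := D) (y := x))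

lemma rpow_mul_mul_rpow_le_one_iff {D X : H →L[ℂ] H} (hD : IsStrictlyPositive D) (x : ℝ) :
    D ^ x * X * D ^ x ≤ 1 ↔ X ≤ D ^ (-(2 * x)) := by
  rw [rpow_mul_mul_rpow_le_iff hD, mul_one, ← CFC.rpow_add hD.isUnit]
  ring_nf

/-- The map `Z ↦ Z P Z` reflects the order on positive operators. -/
lemma le_of_mul_mul_le_mul_mul {P Z W : H →L[ℂ] H} (hP : IsStrictlyPositive P)
    (hZ : 0 ≤ Z) (hW : 0 ≤ W) (h : Z * P * Z ≤ W * P * W) : Z ≤ W := by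
  have hS : P ^ (1 / 2 : ℝ) * P ^ (1 / 2 : ℝ) = P := by
    rw [← CFC.rpow_add hP.isUnit, add_halves, CFC.rpow_one P hP.nonneg]
  set S := P ^ (1 / 2 : ℝ)
  have hS0 : 0 ≤ S := CFC.rpow_nonneg
  have hsq : ∀ X : H →L[ℂ] H, S * (X * P * X) * S = S * X * S * (S * X * S) := by
    intro X
    rw [← hS]
    simp only [mul_assoc]
  have hpos : ∀ X : H →L[ℂ] H, 0 ≤ X → 0 ≤ S * X * S := fun X hX => by
    simpa using conjugate_le_conjugate_of_nonneg hX hS0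
  -- With `S = P ^ (1/2)`, `S (X P X) S = (S X S)²`, so operator monotonicity of the square root
  -- applies.
  have h1 := CFC.sqrt_le_sqrt _ _ (conjugate_le_conjugate_of_nonneg h hS0)
  rw [hsq, hsq, CFC.sqrt_mul_self _ (hpos Z hZ), CFC.sqrt_mul_self _ (hpos W hW)] at h1
  have h2 := (rpow_mul_mul_rpow_le_iff hP (1 / 2)).1 h1
  rwa [rpow_neg_mul_rpow_mul_mul hP] at h2

lemma rpow_mul_rpow_mul_rpow {A : H →L[ℂ] H} (hA : IsStrictlyPositive A) (x y z : ℝ) :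
    A ^ x * A ^ y * A ^ z = A ^ (x + y + z) := by
  rw [CFC.rpow_add hA.isUnit, CFC.rpow_add hA.isUnit]

lemma isStrictlyPositive_rpow_mul_mul_rpow {A X : H →L[ℂ] H} (hA : IsStrictlyPositive A)
    (hX : IsStrictlyPositive X) (x : ℝ) : IsStrictlyPositive (A ^ x * X * A ^ x) := by
  rw [IsStrictlyPositive.iff_of_unital]
  refine ⟨?_, ?_⟩
  · simpa using conjugate_le_conjugate_of_nonneg hX.nonneg (CFC.rpow_nonneg (a := A) (y := x))
  · exact ((hA.rpow A x).isUnit.mul hX.isUnit).mul (hA.rpow A x).isUnit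

/-- Real powers reverse `X ≤ Y ^ (-p)` into `Y ^ p ≤ X ^ (-1)`. -/
lemma rpow_le_rpow_neg_one {X Y : H →L[ℂ] H} (hX : IsStrictlyPositive X)
    (hY : IsStrictlyPositive Y) {p : ℝ} (hp : p ≠ 0) (h : X ≤ Y ^ (-p)) :
    Y ^ p ≤ X ^ (-1 : ℝ) := by
  have h1 := CStarAlgebra.rpow_neg_one_le_rpow_neg_one h hX
  rwa [CFC.rpow_rpow Y _ _ (neg_ne_zero.2 hp) hY, neg_mul_neg, mul_one] at h1

lemma geomMean_inverse_eq {A : H →L[ℂ] H} (hA : IsStrictlyPositive A) (B : H →L[ℂ] H) :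
    geomMean (1 / 2) (Ring.inverse A) B =
      A ^ (-(1 / 2) : ℝ) * (A ^ (1 / 2 : ℝ) * B * A ^ (1 / 2 : ℝ)) ^ (1 / 2 : ℝ) *
        A ^ (-(1 / 2) : ℝ) := by
  rw [geomMean, CFC.inverse_eq_rpow_neg_one hA, CFC.rpow_rpow A _ _ (by norm_num) hA,
    CFC.rpow_rpow A _ _ (by norm_num) hA]
  norm_num

lemma isStrictlyPositive_geomMean_inverse {A B : H →L[ℂ] H} (hA : IsStrictlyPositive A)
    (hB : IsStrictlyPositive B) :
    IsStrictlyPositive (geomMean (1 / 2) (Ring.inverse A) B) := by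
  rw [geomMean_inverse_eq hA]
  exact isStrictlyPositive_rpow_mul_mul_rpow hA
    ((isStrictlyPositive_rpow_mul_mul_rpow hA hB _).rpow _ _) _

/-- `A⁻¹ # B` solves the Riccati equation `D A D = B`. -/
lemma geomMean_inverse_mul_mul {A B : H →L[ℂ] H} (hA : IsStrictlyPositive A)
    (hB : IsStrictlyPositive B) :
    geomMean (1 / 2) (Ring.inverse A) B * A * geomMean (1 / 2) (Ring.inverse A) B = B := by
  have hM := isStrictlyPositive_rpow_mul_mul_rpow hA hB (1 / 2)
  rw [geomMean_inverse_eq hA]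
  set R := A ^ (-(1 / 2) : ℝ)
  set S := A ^ (1 / 2 : ℝ)
  set M := S * B * S
  have hRAR : R * A * R = 1 := CFC.conjugate_rpow_neg_one_half A hA
  have hRS : R * S = 1 := CFC.rpow_neg_mul_rpow _ hA
  have hSR : S * R = 1 := CFC.rpow_mul_rpow_neg _ hA
  have hMM : M ^ (1 / 2 : ℝ) * M ^ (1 / 2 : ℝ) = M := by
    rw [← CFC.rpow_add hM.isUnit, add_halves, CFC.rpow_one M hM.nonneg]
  calc R * M ^ (1 / 2 : ℝ) * R * A * (R * M ^ (1 / 2 : ℝ) * R)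
      = R * M ^ (1 / 2 : ℝ) * (R * A * R) * (M ^ (1 / 2 : ℝ) * R) := by simp only [mul_assoc]
    _ = R * (M ^ (1 / 2 : ℝ) * M ^ (1 / 2 : ℝ)) * R := by
        rw [hRAR, mul_one]; simp only [mul_assoc]
    _ = (R * S) * B * (S * R) := by rw [hMM]; simp only [M, mul_assoc]
    _ = B := by rw [hRS, hSR, one_mul, mul_one]

lemma spectralGeomMean_le_one_iff {A B : H →L[ℂ] H} (hA : IsStrictlyPositive A)
    (hB : IsStrictlyPositive B) (t : ℝ) :
    spectralGeomMean t A B ≤ 1 ↔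
      A ≤ geomMean (1 / 2) (Ring.inverse A) B ^ (-(2 * t)) :=
  rpow_mul_mul_rpow_le_one_iff (isStrictlyPositive_geomMean_inverse hA hB) t

/-- Conjugate `A ≤ D ^ (-2t)` by `D = A⁻¹ # B` and use `D A D = B`. -/
lemma spectralGeomMean_le_one_iff' {A B : H →L[ℂ] H} (hA : IsStrictlyPositive A)
    (hB : IsStrictlyPositive B) (t : ℝ) :
    spectralGeomMean t A B ≤ 1 ↔
      B ≤ geomMean (1 / 2) (Ring.inverse A) B ^ (2 * (1 - t)) := by
  have hD := isStrictlyPositive_geomMean_inverse hA hB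
  have hDAD := geomMean_inverse_mul_mul hA hB
  rw [spectralGeomMean_le_one_iff hA hB]
  set D := geomMean (1 / 2) (Ring.inverse A) B
  have h1 := rpow_mul_mul_rpow_le_iff (X := A) (Y := D ^ (2 * (1 - t))) hD 1
  rw [CFC.rpow_one D hD.nonneg, hDAD, rpow_mul_rpow_mul_rpow hD] at h1
  rw [h1]
  ring_nf

/-- The case `t ≤ 1 / 2`. -/
theorem spectralGeomMean_rpow_le_one_of_le_half {A B : H →L[ℂ] H}
    (hA : IsStrictlyPositive A) (hB : IsStrictlyPositive B) {t r s : ℝ} (ht0 : 0 < t)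
    (ht : t ≤ 1 / 2) (hs0 : 0 < s) (hs : s ≤ t / (1 - t)) (hr0 : 0 < r)
    (hr : r ≤ s * (1 - t) / t) (h : spectralGeomMean t A B ≤ 1) :
    spectralGeomMean (r * t / (s * (1 - t) + r * t)) (A ^ r) (B ^ s) ≤ 1 := by
  have ht1 : 0 < 1 - t := by linarith
  have hAr := hA.rpow A r
  have hBs := hB.rpow B s
  have hC := isStrictlyPositive_geomMean_inverse hA hB
  have hCA := (spectralGeomMean_le_one_iff hA hB t).1 h
  have hCB := (spectralGeomMean_le_one_iff' hA hB t).1 h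
  have hD := isStrictlyPositive_geomMean_inverse hAr hBs
  have hDAD := geomMean_inverse_mul_mul hAr hBs
  rw [spectralGeomMean_le_one_iff hAr hBs]
  set C := geomMean (1 / 2) (Ring.inverse A) B
  set D := geomMean (1 / 2) (Ring.inverse (A ^ r)) (B ^ s)
  -- `σ` makes `2(1-t)s = 2tσ`, so the powers of `C` bounding `B ^ s` and `A ^ (-σ)` coincide.
  obtain ⟨σ, hσ⟩ : ∃ σ, σ = s * (1 - t) / t := ⟨_, rfl⟩
  have hσt : s * (1 - t) = σ * t := by rw [hσ]; field_simp
  have hσ0 : 0 < σ := by rw [hσ]; positivity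
  rw [← hσ] at hr
  rw [le_div_iff₀ ht1] at hs
  have hσ1 : σ ≤ 1 := by rw [hσ, div_le_one ht0]; exact hs
  have hs1 : s ≤ 1 := by nlinarith
  have hα : r * t / (s * (1 - t) + r * t) = r / (σ + r) := by
    rw [hσt, ← add_mul, mul_div_mul_right _ _ ht0.ne']
  rw [hα]
  have hBA : B ^ s ≤ A ^ (-σ) := by
    have h1 := CFC.rpow_le_rpow ⟨hs0.le, hs1⟩ hCB
    have h2 := CFC.rpow_le_rpow ⟨hσ0.le, hσ1⟩
      (rpow_le_rpow_neg_one hA hC (by positivity) hCA)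
    rw [CFC.rpow_rpow C _ _ (by positivity) hC] at h1 h2
    rw [CFC.rpow_rpow A _ _ (by norm_num) hA, neg_one_mul] at h2
    rw [show 2 * (1 - t) * s = 2 * t * σ by linarith] at h1
    exact h1.trans h2
  -- `W = A ^ (-(r+σ)/2)` solves `W A ^ r W = A ^ (-σ)`.
  have hDW : D ≤ A ^ (-((r + σ) / 2)) := by
    refine le_of_mul_mul_le_mul_mul hAr hD.nonneg CFC.rpow_nonneg ?_
    rw [hDAD, rpow_mul_rpow_mul_rpow hA]
    convert hBA using 2
    ring
  have h3 : D ^ (2 * (r / (σ + r))) ≤ A ^ (-r) := by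
    have h4 := CFC.rpow_le_rpow (p := 2 * (r / (σ + r)))
      -- The exponent is at most `1` exactly because `r ≤ σ`.
      ⟨by positivity, by rw [← mul_div_assoc, div_le_one (by positivity)]; linarith⟩ hDW
    rw [CFC.rpow_rpow A _ _ (neg_ne_zero.2 (by positivity)) hA] at h4
    convert h4 using 2
    field_simp
    ring
  have h5 := CStarAlgebra.rpow_neg_one_le_rpow_neg_one h3 (hD.rpow D _)
  rw [CFC.rpow_rpow A _ _ (by simpa using hr0.ne') hA,
    CFC.rpow_rpow D _ _ (by positivity) hD] at h5
  simpa using h5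

/-- The case `1 / 2 ≤ t`. -/
theorem spectralGeomMean_rpow_le_one_of_half_le {A B : H →L[ℂ] H}
    (hA : IsStrictlyPositive A) (hB : IsStrictlyPositive B) {t r s : ℝ} (ht : 1 / 2 ≤ t)
    (ht1 : t < 1) (hr0 : 0 < r) (hr : r ≤ (1 - t) / t) (hs0 : 0 < s)
    (hs : s ≤ r * t / (1 - t)) (h : spectralGeomMean t A B ≤ 1) :
    spectralGeomMean (r * t / (s * (1 - t) + r * t)) (A ^ r) (B ^ s) ≤ 1 := by
  have ht0 : 0 < t := by linarith
  have ht1' : 0 < 1 - t := by linarith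
  have hAr := hA.rpow A r
  have hBs := hB.rpow B s
  have hC := isStrictlyPositive_geomMean_inverse hA hB
  have hCA := (spectralGeomMean_le_one_iff hA hB t).1 h
  have hCB := (spectralGeomMean_le_one_iff' hA hB t).1 h
  have hD := isStrictlyPositive_geomMean_inverse hAr hBs
  have hDAD := geomMean_inverse_mul_mul hAr hBs
  rw [spectralGeomMean_le_one_iff' hAr hBs]
  set C := geomMean (1 / 2) (Ring.inverse A) B
  set D := geomMean (1 / 2) (Ring.inverse (A ^ r)) (B ^ s)
  obtain ⟨σ, hσ⟩ : ∃ σ, σ = r * t / (1 - t) := ⟨_, rfl⟩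
  have hσt : r * t = σ * (1 - t) := by rw [hσ]; field_simp
  have hσ0 : 0 < σ := by rw [hσ]; positivity
  rw [← hσ] at hs
  rw [le_div_iff₀ ht0] at hr
  have hσ1 : σ ≤ 1 := by rw [hσ, div_le_one ht1']; exact hr
  have hr1 : r ≤ 1 := by nlinarith
  have hα : 1 - r * t / (s * (1 - t) + r * t) = s / (s + σ) := by
    rw [hσt, ← add_mul, mul_div_mul_right _ _ ht1'.ne']
    field_simp
    ring
  rw [hα]
  have hAB : A ^ r ≤ B ^ (-σ) := by
    have h1 := CFC.rpow_le_rpow ⟨hr0.le, hr1⟩ hCA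
    have h2 := CStarAlgebra.rpow_neg_one_le_rpow_neg_one
      (CFC.rpow_le_rpow ⟨hσ0.le, hσ1⟩ hCB) (hB.rpow B _)
    rw [CFC.rpow_rpow C _ _ (neg_ne_zero.2 (by positivity)) hC] at h1
    rw [CFC.rpow_rpow C _ _ (by positivity) hC, CFC.rpow_rpow C _ _ (by positivity) hC,
      CFC.rpow_rpow B _ _ hσ0.ne' hB, mul_neg_one, mul_neg_one] at h2
    rw [show -(2 * t) * r = -(2 * (1 - t) * σ) by linarith] at h1
    exact h1.trans h2
  -- `W = B ^ ((s+σ)/2)` solves `W B ^ (-σ) W = B ^ s`, and `B ^ s = D A ^ r D`.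
  have hWD : B ^ ((s + σ) / 2) ≤ D := by
    refine le_of_mul_mul_le_mul_mul hAr CFC.rpow_nonneg hD.nonneg ?_
    rw [hDAD]
    have h3 := conjugate_le_conjugate_of_nonneg hAB
      (CFC.rpow_nonneg (a := B) (y := (s + σ) / 2))
    rw [rpow_mul_rpow_mul_rpow hB] at h3
    convert h3 using 2
    ring
  have h4 := CFC.rpow_le_rpow (p := 2 * (s / (s + σ)))
    ⟨by positivity, by rw [← mul_div_assoc, div_le_one (by positivity)]; linarith⟩ hWD
  rw [CFC.rpow_rpow B _ _ (by positivity) hB] at h4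
  convert h4 using 2
  field_simp

end OperatorInequalities

theorem mainTheorem6 {H : Type*} [NormedAddCommGroup H] [InnerProductSpace ℂ H]
    [CompleteSpace H] (A B : H →L[ℂ] H) (hA : IsStrictlyPositive A)
    (hB : IsStrictlyPositive B) :
    (∀ t r s : ℝ, 0 < t → t ≤ 1 / 2 → 0 < s → s ≤ t / (1 - t) →
      0 < r → r ≤ s * (1 - t) / t →
      spectralGeomMean t A B ≤ 1 →
      spectralGeomMean (r * t / (s * (1 - t) + r * t)) (A ^ r) (B ^ s) ≤ 1) ∧
    (∀ t r s : ℝ, 1 / 2 ≤ t → t < 1 → 0 < r → r ≤ (1 - t) / t →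
      0 < s → s ≤ r * t / (1 - t) →
      spectralGeomMean t A B ≤ 1 →
      spectralGeomMean (r * t / (s * (1 - t) + r * t)) (A ^ r) (B ^ s) ≤ 1) ∧
    (∀ r s : ℝ, 0 < r → r ≤ 1 → 0 < s → s ≤ 1 →
      spectralGeomMean (1 / 2) A B ≤ 1 →
      spectralGeomMean (r / (r + s)) (A ^ r) (B ^ s) ≤ 1) := by
  refine ⟨fun t r s ht0 ht hs0 hs hr0 hr h =>
      spectralGeomMean_rpow_le_one_of_le_half hA hB ht0 ht hs0 hs hr0 hr h,
    fun t r s ht ht1 hr0 hr hs0 hs h =>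
      spectralGeomMean_rpow_le_one_of_half_le hA hB ht ht1 hr0 hr hs0 hs h,
    fun r s hr0 hr hs0 hs h => ?_⟩
  have hα : r / (r + s) = r * (1 / 2) / (s * (1 - 1 / 2) + r * (1 / 2)) := by
    field_simp
    ring
  rw [hα]
  -- At `t = 1/2` the two cases cover `r ≤ s ≤ 1` and `s ≤ r ≤ 1`.
  rcases le_total r s with hrs | hrs
  · exact spectralGeomMean_rpow_le_one_of_le_half hA hB (by norm_num) le_rfl hs0
      (by norm_num; exact hs) hr0 (by norm_num; linarith) h
  · exact spectralGeomMean_rpow_le_one_of_half_le hA hB le_rfl (by norm_num) hr0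
      (by norm_num; exact hr) hs0 (by norm_num; linarith) h
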